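/- Let $\mathcal G=(\mathcal X,\mathcal E)$ be a finite directed acyclic graph whose nodes are random variables (with values in arbitrary measurable spaces) on a common standard Borel probability space. For a node $x$ let $Pa_x$ be the set of its parents (nodes $y$ with $y\to x\in\mathcal E$), $Ch_x$ the set of its children (nodes $y$ with $x\to y\in\mathcal E$), and let the spouses of $x$ be the nodes $y\neq x$ for which there is a node $z$ with $x\to z\leftarrow y$. The Markov blanket $MB_x$ of $x$ is the union of $Pa_x$, $Ch_x$ and the set of spouses of $x$. Assume that the joint distribution $P$ of the variables factorizes according to $\mathcal G$, $$P=\prod_{x\in\mathcal X}P(x\mid Pa_x),$$ that is, for some conditional probability distributions (Markov kernels) $\kappa_x$ from the values of $Pa_x$ to the values of $x$, $P$ is the product of the $\kappa_x$, taken along a topological order of the nodes. Let $x\neq y$ be two nodes with $y\notin MB_x$. Then $$x\perp\!\!\!\perp y\mid MB_x\qquad\text{and}\qquad x\perp\!\!\!\perp y\mid MB_y .$$ Moreover, for every set of nodes $Z\subset\mathcal X$ with $x,y\notin Z$ and $Z\cap MB_x=\emptyset$, $$x\perp\!\!\!\perp y\mid MB_x\cup Z .$$ Here $\perp\!\!\!\perp$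 denotes conditional independence of random variables under $P$. -/

import Mathlib

open MeasureTheory ProbabilityTheory
open scoped ENNReal

namespace BayesNet

section Graph

variable {V : Type*}

/-- A directed graph is acyclic if no directed path of positive length returns to its start. -/
def IsAcyclic (G : Digraph V) : Prop :=
  ∀ v, ¬ Relation.TransGen G.Adj v v

/-- The set of parents `Pa_x`. -/
def parents (G : Digraph V) (x : V) : Set V := {y | G.Adj y x}

/-- The set of children `Ch_x`. -/
def children (G : Digraph V) (x : V) : Set V := {y | G.Adj x y}

/-- The spouses of `x`: the other nodes that share a child with `x`. -/
def spouses (G : Digraph V) (x : V) : Set V := {y | y ≠ x ∧ ∃ z, G.Adj x z ∧ G.Adj y z}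

/-- The Markov blanket `MB_x`: parents, children and spouses of `x`. -/
def markovBlanket (G : Digraph V) (x : V) : Set V :=
  parents G x ∪ children G x ∪ spouses G x

/-- `l` lists every node exactly once, and no edge points from a later entry to an earlier one. -/
def IsTopologicalOrder (G : Digraph V) (l : List V) : Prop :=
  l.Nodup ∧ (∀ v, v ∈ l) ∧ l.Pairwise fun u v => ¬ G.Adj v u

end Graph

section Probability

variable {V : Type*} {α : V → Type*} [∀ v, MeasurableSpace (α v)]

/-- The iterated integral
`∫ κ_{v₁}(dx_{v₁} | x_{Pa v₁}) ⋯ ∫ κ_{vₙ}(dx_{vₙ} | x_{Pa vₙ}) f(x)` along the list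
`[v₁, …, vₙ]`; the coordinates outside the list are those of the given point. -/
noncomputable def iteratedLIntegral [DecidableEq V] (G : Digraph V)
    (κ : ∀ v, Kernel (∀ u : parents G v, α u) (α v)) (f : (∀ v, α v) → ℝ≥0∞) :
    List V → (∀ v, α v) → ℝ≥0∞
  | [], x => f x
  | v :: l, x =>
      ∫⁻ a, iteratedLIntegral G κ f l (Function.update x v a) ∂(κ v fun u => x u)

/-- The joint law of `X` is the product `P = ∏_v P(x_v | x_{Pa v})` of conditional probability
distributions (Markov kernels), i.e. `P(dx) = ∏_v κ_v(x_{Pa v}, dx_v)`, where the product is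
evaluated in a topological order of the nodes. -/
def Factorizes [DecidableEq V] {Ω : Type*} [MeasurableSpace Ω] (G : Digraph V)
    (X : ∀ v, Ω → α v) (μ : Measure Ω) : Prop :=
  ∃ κ : ∀ v, Kernel (∀ u : parents G v, α u) (α v), (∀ v, IsMarkovKernel (κ v)) ∧
    ∃ l : List V, IsTopologicalOrder G l ∧
      ∀ f : (∀ v, α v) → ℝ≥0∞, Measurable f → ∀ x₀ : ∀ v, α v,
        ∫⁻ ω, f (fun v => X v ω) ∂μ = iteratedLIntegral G κ f l x₀

/-- `X_x` and `X_y` are conditionally independent given the family `(X_u)_{u ∈ S}`. -/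
def CondIndepGiven {Ω : Type*} [MeasurableSpace Ω] [StandardBorelSpace Ω]
    (X : ∀ v, Ω → α v) (hX : ∀ v, Measurable (X v)) (μ : Measure Ω) [IsFiniteMeasure μ]
    (x y : V) (S : Set V) : Prop :=
  CondIndepFun (MeasurableSpace.comap (fun ω (u : S) => X u ω) inferInstance)
    (Measurable.comap_le (measurable_pi_lambda _ fun u => hX u)) (X x) (X y) μ

end Probability

end BayesNet

/-! Conditional independence is used in an asymmetric form: conditioning the events of `A` on a
large σ-algebra `E` gives no more than conditioning on `C` (`ScreensOff`). Tower property and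
symmetry then yield the graphoid rules (decomposition, weak union, contraction).

The factorization says that each node, given all its predecessors in the topological order, depends
only on its parents (`screensOff_parents`). Nodes are then added one at a time in that order:
`screensOff_blanketWithin` shows that on every prefix containing `x`, the blanket of `x` formed
inside that prefix separates `x` from the rest. The full list gives the true Markov blanket, and
weak union enlarges the conditioning set. -/

namespace BayesNet

/-! ### Calculus of screening off for σ-algebras. -/

section ScreensOff

variable {Ω : Type*} {A B C D E : MeasurableSpace Ω} {mΩ : MeasurableSpace Ω} {μ : Measure Ω}

/-- The conditional probabilities of the events of `A` given `E` agree with those given `C`. -/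
def ScreensOff (A C E : MeasurableSpace Ω) {mΩ : MeasurableSpace Ω} (μ : Measure Ω) : Prop :=
  ∀ a, MeasurableSet[A] a → μ⟦a | E⟧ =ᵐ[μ] μ⟦a | C⟧

theorem ScreensOff.trans (h₁ : ScreensOff A D E μ)
    (h₂ : ScreensOff A C D μ) : ScreensOff A C E μ :=
  fun a ha => (h₁ a ha).trans (h₂ a ha)

theorem ScreensOff.symm (h : ScreensOff A C D μ) :
    ScreensOff A D C μ :=
  fun a ha => (h a ha).symm

/-- Tower property: condition both sides on `D`; the right side, being `C`-measurable, is unchanged.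
-/
theorem ScreensOff.of_le [IsFiniteMeasure μ]
    (h : ScreensOff A C E μ) (hCD : C ≤ D) (hDE : D ≤ E) (hE : E ≤ mΩ) :
    ScreensOff A C D μ := by
  intro a ha
  have h₁ : μ[μ⟦a | E⟧ | D] =ᵐ[μ] μ⟦a | D⟧ := condExp_condExp_of_le hDE hE
  have h₂ : μ[μ⟦a | E⟧ | D] =ᵐ[μ] μ[μ⟦a | C⟧ | D] := condExp_congr_ae (h a ha)
  rw [condExp_of_stronglyMeasurable (hDE.trans hE) (stronglyMeasurable_condExp.mono hCD)
    integrable_condExp] at h₂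
  exact h₁.symm.trans h₂

theorem ScreensOff.of_le_of_le [IsFiniteMeasure μ]
    (h : ScreensOff A C E μ) (hCD : C ≤ D) (hDE : D ≤ E) (hE : E ≤ mΩ) :
    ScreensOff A D E μ :=
  h.trans (h.of_le hCD hDE hE).symm

theorem measurableSpace_sup_eq_generateFrom (B C : MeasurableSpace Ω) :
    B ⊔ C = MeasurableSpace.generateFrom
      {s | ∃ b c, MeasurableSet[B] b ∧ MeasurableSet[C] c ∧ b ∩ c = s} := by
  apply le_antisymm
  · refine sup_le (fun b hb => ?_) (fun c hc => ?_)
    · exact MeasurableSpace.measurableSet_generateFrom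
        ⟨b, Set.univ, hb, MeasurableSet.univ, Set.inter_univ b⟩
    · exact MeasurableSpace.measurableSet_generateFrom
        ⟨Set.univ, c, MeasurableSet.univ, hc, Set.univ_inter c⟩
  · refine MeasurableSpace.generateFrom_le ?_
    rintro _ ⟨b, c, hb, hc, rfl⟩
    exact MeasurableSet.inter ((le_sup_left : B ≤ B ⊔ C) b hb) ((le_sup_right : C ≤ B ⊔ C) c hc)

theorem isPiSystem_inter (B C : MeasurableSpace Ω) :
    IsPiSystem {s | ∃ b c, MeasurableSet[B] b ∧ MeasurableSet[C] c ∧ b ∩ c = s} := by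
  rintro _ ⟨b, c, hb, hc, rfl⟩ _ ⟨b', c', hb', hc', rfl⟩ -
  exact ⟨b ∩ b', c ∩ c', hb.inter hb', hc.inter hc', Set.inter_inter_inter_comm _ _ _ _⟩

theorem integrable_indicator_one [IsFiniteMeasure μ] {a : Set Ω} (ha : MeasurableSet a) :
    Integrable (a.indicator fun _ => (1 : ℝ)) μ :=
  (integrable_const 1).indicator ha

theorem indicator_inter_eq_mul (a b : Set Ω) :
    ((a ∩ b).indicator fun _ => (1 : ℝ))
      = (b.indicator fun _ => (1 : ℝ)) * (a.indicator fun _ => (1 : ℝ)) := by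
  ext ω
  by_cases h₁ : ω ∈ a <;> by_cases h₂ : ω ∈ b <;> simp [h₁, h₂]

theorem indicator_mul_eq_indicator (b : Set Ω) (f : Ω → ℝ) :
    (b.indicator fun _ => (1 : ℝ)) * f = b.indicator f := by
  ext ω
  by_cases h₂ : ω ∈ b <;> simp [h₂]

theorem condExp_indicator_mul_condExp [IsFiniteMeasure μ]
    {a b : Set Ω} (hb : MeasurableSet b) :
    μ[(b.indicator fun _ => (1 : ℝ)) * μ⟦a | C⟧ | C] =ᵐ[μ] μ⟦b | C⟧ * μ⟦a | C⟧ := by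
  refine condExp_mul_of_stronglyMeasurable_right stronglyMeasurable_condExp ?_
    (integrable_indicator_one hb)
  rw [indicator_mul_eq_indicator]
  exact integrable_condExp.indicator hb

/-- Turns the symmetric product formula into the one-sided form; `swap` gets its symmetry from here.
-/
theorem condIndep_iff_screensOff [StandardBorelSpace Ω] [IsFiniteMeasure μ]
    (hA : A ≤ mΩ) (hB : B ≤ mΩ) (hC : C ≤ mΩ) :
    CondIndep C A B hC μ ↔ ScreensOff A C (B ⊔ C) μ := by
  rw [condIndep_iff C A B hC hA hB]
  have hBC : B ⊔ C ≤ mΩ := sup_le hB hC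
  constructor
  · intro h a ha
    have hia : Integrable (a.indicator fun _ => (1 : ℝ)) μ := integrable_indicator_one (hA a ha)
    have hsm : StronglyMeasurable[B ⊔ C] (μ⟦a | C⟧) :=
      stronglyMeasurable_condExp.mono (le_sup_right : C ≤ B ⊔ C)
    symm
    refine ae_eq_condExp_of_forall_setIntegral_eq hBC hia
      (fun _ _ _ => integrable_condExp.integrableOn) (fun s hs _ => ?_)
      hsm.aestronglyMeasurable
    -- π-λ argument: the sets `b ∩ c` generate `B ⊔ C`, and on them the identity is the product
    -- formula integrated over `c`.
    have key : ∀ s, MeasurableSet[B ⊔ C] s →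
        ∫ ω in s, (μ⟦a | C⟧) ω ∂μ = ∫ ω in s, a.indicator (fun _ => (1 : ℝ)) ω ∂μ := by
      intro s hs
      induction s, hs using MeasurableSpace.induction_on_inter
        (measurableSpace_sup_eq_generateFrom B C) (isPiSystem_inter B C) with
      | empty => simp
      | basic s hs =>
        obtain ⟨b, c, hb, hc, rfl⟩ := hs
        rw [Set.inter_comm b c, ← setIntegral_indicator (hB b hb),
          ← setIntegral_indicator (hB b hb), ← indicator_mul_eq_indicator b (μ⟦a | C⟧),
          ← indicator_mul_eq_indicator b (a.indicator _), ← indicator_inter_eq_mul]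
        have hib : Integrable ((b.indicator fun _ => (1 : ℝ)) * μ⟦a | C⟧) μ := by
          rw [indicator_mul_eq_indicator]; exact integrable_condExp.indicator (hB b hb)
        rw [← setIntegral_condExp hC hib hc, ← setIntegral_condExp hC
          (integrable_indicator_one ((hA a ha).inter (hB b hb))) hc]
        refine setIntegral_congr_ae (hC c hc) ?_
        filter_upwards [h a b ha hb, condExp_indicator_mul_condExp (C := C) (a := a) (hB b hb)]
          with ω h₁ h₂ _
        rw [h₁, h₂, mul_comm]
      | compl s hs ih =>
        have h₁ := integral_add_compl (hBC s hs) (integrable_condExp (m := C) (μ := μ)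
          (f := a.indicator fun _ => (1 : ℝ)))
        have h₂ := integral_add_compl (hBC s hs) hia
        rw [integral_condExp hC] at h₁
        linarith
      | iUnion f hd hf ih =>
        rw [integral_iUnion (fun i => hBC _ (hf i)) hd integrable_condExp.integrableOn,
          integral_iUnion (fun i => hBC _ (hf i)) hd hia.integrableOn]
        exact tsum_congr ih
    exact key s hs
  · intro h a b ha hb
    have hbE : MeasurableSet[B ⊔ C] b := (le_sup_left : B ≤ B ⊔ C) b hb
    have h₁ : μ[μ⟦a ∩ b | B ⊔ C⟧ | C] =ᵐ[μ] μ⟦a ∩ b | C⟧ :=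
      condExp_condExp_of_le le_sup_right hBC
    have h₂ : μ⟦a ∩ b | B ⊔ C⟧ =ᵐ[μ] (b.indicator fun _ => (1 : ℝ)) * μ⟦a | C⟧ := by
      rw [indicator_inter_eq_mul, indicator_mul_eq_indicator, indicator_mul_eq_indicator]
      refine (condExp_indicator (integrable_indicator_one (hA a ha)) hbE).trans ?_
      filter_upwards [h a ha] with ω hω
      simp only [Set.indicator, hω]
    refine (h₁.symm.trans (condExp_congr_ae h₂)).trans ?_
    exact (condExp_indicator_mul_condExp (hB b hb)).trans (by rw [mul_comm])

theorem ScreensOff.swap [StandardBorelSpace Ω] [IsFiniteMeasure μ]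
    (hA : A ≤ mΩ) (hB : B ≤ mΩ) (hC : C ≤ mΩ)
    (h : ScreensOff A C (B ⊔ C) μ) : ScreensOff B C (A ⊔ C) μ :=
  (condIndep_iff_screensOff hB hA hC).1 ((condIndep_iff_screensOff hA hB hC).2 h).symm

end ScreensOff

/-! ### σ-algebras generated by sets of nodes. -/

section Sigma

variable {V : Type*} {α : V → Type*} [∀ v, MeasurableSpace (α v)] {Ω : Type*}

/-- The `σ`-algebra generated by the variables `X_u`, `u ∈ S`. -/
abbrev sigmaOf (X : ∀ v, Ω → α v) (S : Set V) : MeasurableSpace Ω :=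
  MeasurableSpace.comap (fun ω (u : S) => X u ω) inferInstance

theorem sigmaOf_eq_iSup (X : ∀ v, Ω → α v) (S : Set V) :
    sigmaOf X S = ⨆ u ∈ S, MeasurableSpace.comap (X u) inferInstance := by
  rw [iSup_subtype', sigmaOf, MeasurableSpace.pi, MeasurableSpace.comap_iSup]
  simp_rw [MeasurableSpace.comap_comp]
  rfl

theorem sigmaOf_mono (X : ∀ v, Ω → α v) {S T : Set V} (h : S ⊆ T) :
    sigmaOf X S ≤ sigmaOf X T := by
  simp_rw [sigmaOf_eq_iSup]
  exact biSup_mono h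

theorem sigmaOf_union (X : ∀ v, Ω → α v) (S T : Set V) :
    sigmaOf X (S ∪ T) = sigmaOf X S ⊔ sigmaOf X T := by
  simp_rw [sigmaOf_eq_iSup]
  exact iSup_union

theorem sigmaOf_singleton (X : ∀ v, Ω → α v) (v : V) :
    sigmaOf X {v} = MeasurableSpace.comap (X v) inferInstance := by
  simp [sigmaOf_eq_iSup]

theorem sigmaOf_le [mΩ : MeasurableSpace Ω] {X : ∀ v, Ω → α v} (hX : ∀ v, Measurable (X v))
    (S : Set V) : sigmaOf X S ≤ mΩ :=
  Measurable.comap_le (measurable_pi_lambda _ fun u => hX u)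

end Sigma

/-! ### From the factorization to the ordered Markov property. -/

section Markov

theorem IsTopologicalOrder.parents_subset {V : Type*} {G : Digraph V} {l p s : List V} {w : V}
    (hl : IsTopologicalOrder G l) (hG : IsAcyclic G) (h : l = p ++ w :: s) :
    parents G w ⊆ {v | v ∈ p} := by
  intro u hu
  obtain ⟨-, hmem, hpw⟩ := hl
  subst h
  rcases List.mem_append.1 (hmem u) with h | h
  · exact h
  rcases List.mem_cons.1 h with rfl | h
  · exact absurd (Relation.TransGen.single hu) (hG u)
  · have h₁ := (List.pairwise_append.1 hpw).2.1
    exact absurd hu ((List.pairwise_cons.1 h₁).1 u h)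

variable {V : Type*} {α : V → Type*} [∀ v, MeasurableSpace (α v)] [DecidableEq V]
  {G : Digraph V} {κ : ∀ v, Kernel (∀ u : parents G v, α u) (α v)}

theorem iteratedLIntegral_append (f : (∀ v, α v) → ℝ≥0∞) (p s : List V) (x : ∀ v, α v) :
    iteratedLIntegral G κ f (p ++ s) x
      = iteratedLIntegral G κ (iteratedLIntegral G κ f s) p x := by
  induction p generalizing x with
  | nil => rfl
  | cons v p ih => simp only [List.cons_append, iteratedLIntegral, ih]

/-- Markov kernels have mass one, so integrating out irrelevant coordinates changes nothing; this
discards the nodes after `w`. -/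
theorem iteratedLIntegral_eq_self [∀ v, IsMarkovKernel (κ v)] {f : (∀ v, α v) → ℝ≥0∞}
    {s : List V} (hf : ∀ v ∈ s, ∀ x a, f (Function.update x v a) = f x) (x : ∀ v, α v) :
    iteratedLIntegral G κ f s x = f x := by
  induction s generalizing x with
  | nil => rfl
  | cons v s ih =>
    have h : ∀ y, iteratedLIntegral G κ f s y = f y :=
      ih fun u hu => hf u (List.mem_cons_of_mem v hu)
    simp only [iteratedLIntegral, h, hf v List.mem_cons_self, lintegral_const, measure_univ,
      mul_one]

variable {Ω : Type*} [mΩ : MeasurableSpace Ω]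

/-- The kernel `κ_w` computes the law of `X_w` jointly with the preceding variables. -/
theorem measure_inter_eq_setLIntegral {μ : Measure Ω} [IsProbabilityMeasure μ]
    {X : ∀ v, Ω → α v} (hX : ∀ v, Measurable (X v)) (hG : IsAcyclic G)
    [∀ v, IsMarkovKernel (κ v)] {l p s : List V} {w : V} (hl : IsTopologicalOrder G l)
    (hμ : ∀ f : (∀ v, α v) → ℝ≥0∞, Measurable f → ∀ x₀ : ∀ v, α v,
      ∫⁻ ω, f (fun v => X v ω) ∂μ = iteratedLIntegral G κ f l x₀)
    (h : l = p ++ w :: s) {c : Set Ω} (hc : MeasurableSet[sigmaOf X {v | v ∈ p}] c)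
    {b : Set (α w)} (hb : MeasurableSet b) :
    μ (c ∩ X w ⁻¹' b) = ∫⁻ ω in c, κ w (fun u => X u ω) b ∂μ := by
  have hpar := hl.parents_subset hG h
  obtain ⟨c', hc', rfl⟩ := hc
  have hnd : (p ++ w :: s).Nodup := h ▸ hl.1
  have hdis : ∀ v ∈ w :: s, v ∉ p := fun v hv hvp => List.disjoint_of_nodup_append hnd hvp hv
  have hws : w ∉ s := (List.nodup_cons.1 (List.nodup_append.1 hnd).2.1).1
  set r : (∀ v, α v) → (∀ u : {v | v ∈ p}, α u) := fun x u => x u with hr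
  have hrm : Measurable r := measurable_pi_lambda _ fun u => measurable_pi_apply _
  have hru : ∀ v ∈ w :: s, ∀ x a, r (Function.update x v a) = r x := by
    intro v hv x a
    funext u
    have : (u : V) ≠ v := fun e => hdis v hv (e ▸ u.2)
    simp [hr, this]
  have hpu : ∀ v ∈ w :: s, ∀ (x : ∀ v, α v) a,
      (fun u : parents G w => Function.update x v a u) = fun u : parents G w => x u := by
    intro v hv x a
    funext u
    have : (u : V) ≠ v := fun e => hdis v hv (e ▸ hpar u.2)
    simp [this]
  -- `g` is `f` with the coordinate `w` integrated out, so both have the same iterated integral over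
  -- `w :: s`.
  set f : (∀ v, α v) → ℝ≥0∞ := fun x => c'.indicator 1 (r x) * b.indicator 1 (x w) with hf
  set g : (∀ v, α v) → ℝ≥0∞ := fun x => c'.indicator 1 (r x) * κ w (fun u => x u) b with hg
  have hCm : Measurable fun x => c'.indicator (fun _ => (1 : ℝ≥0∞)) (r x) :=
    (measurable_const.indicator hc').comp hrm
  have hfm : Measurable f :=
    hCm.mul ((measurable_one.indicator hb).comp (measurable_pi_apply w))
  have hgm : Measurable g :=
    hCm.mul (((κ w).measurable_coe hb).comp
      (measurable_pi_lambda _ fun u => measurable_pi_apply _))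
  have hgu : ∀ v ∈ w :: s, ∀ x a, g (Function.update x v a) = g x := by
    intro v hv x a
    simp only [hg, hru v hv, hpu v hv]
  have hfu : ∀ v ∈ s, ∀ x a, f (Function.update x v a) = f x := by
    intro v hv x a
    have hvw : w ≠ v := fun e => hws (e ▸ hv)
    simp only [hf, hru v (List.mem_cons_of_mem w hv), Function.update_of_ne hvw]
  have hfg : iteratedLIntegral G κ f (w :: s) = iteratedLIntegral G κ g (w :: s) := by
    funext x
    rw [iteratedLIntegral_eq_self hgu]
    simp only [iteratedLIntegral, iteratedLIntegral_eq_self hfu]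
    simp only [hf, hg, hru w List.mem_cons_self, Function.update_self]
    rw [lintegral_const_mul _ (measurable_one.indicator hb), lintegral_indicator_one hb]
  obtain ⟨ω₀⟩ : Nonempty Ω := nonempty_of_isProbabilityMeasure μ
  have key : ∫⁻ ω, f (fun v => X v ω) ∂μ = ∫⁻ ω, g (fun v => X v ω) ∂μ := by
    rw [hμ f hfm fun v => X v ω₀, hμ g hgm fun v => X v ω₀, h, iteratedLIntegral_append,
      iteratedLIntegral_append, hfg]
  have hXm : Measurable fun ω (u : {v | v ∈ p}) => X u ω :=
    measurable_pi_lambda _ fun u => hX u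
  have hcm : MeasurableSet ((fun ω (u : {v | v ∈ p}) => X u ω) ⁻¹' c') := hXm hc'
  rw [← lintegral_indicator hcm, ← lintegral_indicator_one (hcm.inter (hX w hb))]
  refine Eq.trans (lintegral_congr fun ω => ?_) (key.trans (lintegral_congr fun ω => ?_))
  · rw [Set.inter_indicator_one]
    rfl
  · change c'.indicator 1 (fun u : {v | v ∈ p} => X u ω) * _ = _
    by_cases h₁ : (fun u : {v | v ∈ p} => X u ω) ∈ c'
    · rw [Set.indicator_of_mem h₁,
        Set.indicator_of_mem (show ω ∈ (fun ω (u : {v | v ∈ p}) => X u ω) ⁻¹' c' from h₁),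
        Pi.one_apply, one_mul]
    · rw [Set.indicator_of_notMem h₁,
        Set.indicator_of_notMem (show ω ∉ (fun ω (u : {v | v ∈ p}) => X u ω) ⁻¹' c' from h₁),
        zero_mul]

/-- The kernel value `k` is a version of the conditional probability given the predecessors and is
already measurable in the parents; the tower property finishes. -/
theorem screensOff_parents {μ : Measure Ω} [IsProbabilityMeasure μ]
    {X : ∀ v, Ω → α v} (hX : ∀ v, Measurable (X v)) (hG : IsAcyclic G)
    [∀ v, IsMarkovKernel (κ v)] {l p s : List V} {w : V} (hl : IsTopologicalOrder G l)
    (hμ : ∀ f : (∀ v, α v) → ℝ≥0∞, Measurable f → ∀ x₀ : ∀ v, α v,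
      ∫⁻ ω, f (fun v => X v ω) ∂μ = iteratedLIntegral G κ f l x₀)
    (h : l = p ++ w :: s) :
    ScreensOff (sigmaOf X {w}) (sigmaOf X (parents G w)) (sigmaOf X {v | v ∈ p}) μ := by
  have hle := sigmaOf_mono X (hl.parents_subset hG h)
  have hpm := sigmaOf_le hX {v | v ∈ p}
  rw [sigmaOf_singleton]
  rintro _ ⟨b, hb, rfl⟩
  set k : Ω → ℝ := fun ω => (κ w (fun u => X u ω)).real b with hk
  have hkm : StronglyMeasurable[sigmaOf X (parents G w)] k :=
    (((κ w).measurable_coe hb).ennreal_toReal.comp (comap_measurable _)).stronglyMeasurable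
  have hkm' := hkm.mono (sigmaOf_le hX (parents G w))
  have hki : Integrable k μ :=
    Integrable.of_bound hkm'.aestronglyMeasurable 1 (ae_of_all _ fun ω => by
      rw [Real.norm_of_nonneg measureReal_nonneg]; exact measureReal_le_one)
  have h₁ : k =ᵐ[μ] μ⟦X w ⁻¹' b | sigmaOf X {v | v ∈ p}⟧ := by
    refine ae_eq_condExp_of_forall_setIntegral_eq hpm (integrable_indicator_one (hX w hb))
      (fun _ _ _ => hki.integrableOn) (fun c hc _ => ?_) (hkm.mono hle).aestronglyMeasurable
    rw [setIntegral_indicator (hX w hb), setIntegral_const, smul_eq_mul, mul_one,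
      measureReal_def, measure_inter_eq_setLIntegral hX hG hl hμ h hc hb]
    have hkm'' : Measurable fun ω => κ w (fun u => X u ω) b :=
      ((κ w).measurable_coe hb).comp (measurable_pi_lambda _ fun u => hX u)
    exact integral_toReal hkm''.aemeasurable (ae_of_all _ fun ω => measure_lt_top _ _)
  have h₂ : μ[μ⟦X w ⁻¹' b | sigmaOf X {v | v ∈ p}⟧ | sigmaOf X (parents G w)]
      =ᵐ[μ] μ⟦X w ⁻¹' b | sigmaOf X (parents G w)⟧ := condExp_condExp_of_le hle hpm
  have h₃ := condExp_congr_ae (m := sigmaOf X (parents G w)) h₁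
  rw [condExp_of_stronglyMeasurable (sigmaOf_le hX _) hkm hki] at h₃
  exact h₁.symm.trans (h₃.trans h₂)

end Markov

/-! ### Growing the Markov blanket along the topological order. -/

section Blanket

variable {V : Type*} {G : Digraph V}

/-- The Markov blanket of `x` in which only the children belonging to `P` are considered. -/
def blanketWithin (G : Digraph V) (x : V) (P : Set V) : Set V :=
  parents G x ∪ ({w | w ∈ P ∧ G.Adj x w} ∪ {u | u ≠ x ∧ ∃ w ∈ P, G.Adj x w ∧ G.Adj u w})

theorem blanketWithin_univ (x : V) : blanketWithin G x Set.univ = markovBlanket G x := by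
  simp [blanketWithin, markovBlanket, children, spouses, Set.union_assoc]

theorem notMem_markovBlanket_self (hG : IsAcyclic G) (x : V) : x ∉ markovBlanket G x := by
  have hx : ¬ G.Adj x x := fun h => hG x (.single h)
  simp [markovBlanket, parents, children, spouses, hx]

variable {α : V → Type*} [∀ v, MeasurableSpace (α v)] {Ω : Type*} {mΩ : MeasurableSpace Ω}
  [StandardBorelSpace Ω] {μ : Measure Ω}

/-- Exchanging the roles of the screened variables: if `T` is irrelevant for `R` given `S`, then
`R` is irrelevant for `T` given `S`. -/
theorem ScreensOff.swap_sigmaOf [IsFiniteMeasure μ] {X : ∀ v, Ω → α v}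
    (hX : ∀ v, Measurable (X v)) {R S T : Set V}
    (h : ScreensOff (sigmaOf X R) (sigmaOf X S) (sigmaOf X (T ∪ S)) μ) :
    ScreensOff (sigmaOf X T) (sigmaOf X S) (sigmaOf X (R ∪ S)) μ := by
  rw [sigmaOf_union] at h ⊢
  exact h.swap (sigmaOf_le hX R) (sigmaOf_le hX T) (sigmaOf_le hX S)

/-- Induction on the prefix. A last node that is not a child of `x` adds nothing; a child adds
itself and its other parents. If `x` itself is last, its blanket is just its parents. -/
theorem screensOff_blanketWithin [DecidableEq V] [IsProbabilityMeasure μ]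
    {κ : ∀ v, Kernel (∀ u : parents G v, α u) (α v)} {X : ∀ v, Ω → α v}
    (hX : ∀ v, Measurable (X v)) (hG : IsAcyclic G)
    [∀ v, IsMarkovKernel (κ v)] {l : List V} (hl : IsTopologicalOrder G l)
    (hμ : ∀ f : (∀ v, α v) → ℝ≥0∞, Measurable f → ∀ x₀ : ∀ v, α v,
      ∫⁻ ω, f (fun v => X v ω) ∂μ = iteratedLIntegral G κ f l x₀)
    (x : V) (p s : List V) (h : l = p ++ s) (hx : x ∈ p) :
    blanketWithin G x {v | v ∈ p} ⊆ {v | v ∈ p} \ {x} ∧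
    ScreensOff (sigmaOf X {x}) (sigmaOf X (blanketWithin G x {v | v ∈ p}))
      (sigmaOf X ({v | v ∈ p} \ {x})) μ := by
  have hirr : ∀ v, ¬ G.Adj v v := fun v hv => hG v (.single hv)
  induction p using List.reverseRecOn generalizing s with
  | nil => simp at hx
  | append_singleton q w ih =>
    have h' : l = q ++ w :: s := by simpa using h
    have hpar : ∀ u, G.Adj u w → u ∈ q := hl.parents_subset hG h'
    have hw := screensOff_parents hX hG hl hμ h'
    have hnd : (q ++ w :: s).Nodup := h' ▸ hl.1
    have hwq : w ∉ q := fun hq => List.disjoint_of_nodup_append hnd hq List.mem_cons_self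
    have hnadj : ∀ u ∈ q, ¬ G.Adj w u := fun u hu =>
      (List.pairwise_append.1 (h' ▸ hl.2.2)).2.2 u hu w List.mem_cons_self
    have hle := sigmaOf_le (mΩ := mΩ) hX
    by_cases hxw : x = w
    · subst hxw
      have e₁ : ({v | v ∈ q ++ [x]} \ {x} : Set V) = {v | v ∈ q} := by
        ext v; simp; grind
      have e₂ : blanketWithin G x {v | v ∈ q ++ [x]} = parents G x := by
        ext v; simp [blanketWithin, parents]; grind
      rw [e₁, e₂]
      exact ⟨hpar, hw⟩
    · have hxq : x ∈ q := by simpa [hxw] using hx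
      obtain ⟨hsub, ih⟩ := ih (w :: s) h' hxq
      set M := blanketWithin G x {v | v ∈ q} with hM
      have eq₁ : ({v | v ∈ q ++ [w]} \ {x} : Set V) = {w} ∪ {v | v ∈ q} \ {x} := by
        ext v; simp; grind
      have eq₂ : {x} ∪ {v | v ∈ q} \ {x} = {v | v ∈ q} := by
        ext v; simp; grind
      rw [eq₁]
      by_cases hadj : G.Adj x w
      · set S := M ∪ parents G w \ {x} with hS
        have e : blanketWithin G x {v | v ∈ q ++ [w]} = {w} ∪ S := by
          ext v; simp [hS, hM, blanketWithin, parents]; grind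
        have hSq : S ⊆ {v | v ∈ q} \ {x} :=
          Set.union_subset hsub (Set.sdiff_subset_sdiff_left hpar)
        have hxS : {x} ∪ S ⊆ {v | v ∈ q} := by
          rw [← eq₂]; exact Set.union_subset_union_right _ hSq
        rw [e]
        refine ⟨Set.union_subset_union_right _ hSq, ?_⟩
        set R : Set V := {v | v ∈ q} \ {x} with hR
        have hRS : R ∪ S = R := Set.union_eq_left.2 hSq
        have h₁ : ScreensOff (sigmaOf X {x}) (sigmaOf X S) (sigmaOf X (R ∪ S)) μ := by
          rw [hRS]
          exact ih.of_le_of_le (sigmaOf_mono X Set.subset_union_left) (sigmaOf_mono X hSq)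
            (hle _)
        have h₂ : ScreensOff (sigmaOf X {w}) (sigmaOf X ({x} ∪ S))
            (sigmaOf X (R ∪ ({x} ∪ S))) μ := by
          have e₃ : R ∪ ({x} ∪ S) = {v | v ∈ q} := by
            rw [Set.union_left_comm, hRS, eq₂]
          rw [e₃]
          refine hw.of_le_of_le (sigmaOf_mono X ?_) (sigmaOf_mono X hxS) (hle _)
          intro u hu
          by_cases hux : u = x
          · exact Or.inl hux
          · exact Or.inr (Or.inr ⟨hu, hux⟩)
        -- Contraction: `R` is independent of `x` given `S`, and of `w` given `S` and `x`, hence of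
        -- the pair given `S`. Weak union then moves `w` into the condition.
        have h₃ := (h₂.swap_sigmaOf hX).trans (h₁.swap_sigmaOf hX)
        rw [Set.union_left_comm] at h₃
        have h₄ := h₃.of_le_of_le (sigmaOf_mono X Set.subset_union_right)
          (sigmaOf_mono X (Set.subset_union_right : {w} ∪ S ⊆ {x} ∪ ({w} ∪ S))) (hle _)
        have h₅ := h₄.swap_sigmaOf hX
        rwa [Set.union_left_comm R, hRS] at h₅
      · have e : blanketWithin G x {v | v ∈ q ++ [w]} = M := by
          ext v; simp [hM, blanketWithin]; grind
        rw [e]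
        refine ⟨hsub.trans Set.subset_union_right, ?_⟩
        have hw' : ScreensOff (sigmaOf X {w}) (sigmaOf X ({v | v ∈ q} \ {x}))
            (sigmaOf X ({x} ∪ {v | v ∈ q} \ {x})) μ := by
          rw [eq₂]
          refine hw.of_le_of_le (sigmaOf_mono X fun u hu => ⟨hpar u hu, ?_⟩)
            (sigmaOf_mono X Set.sdiff_subset) (hle _)
          rintro rfl
          exact hadj hu
        -- Given the rest of the prefix, `w` ignores `x`; by symmetry `x` ignores `w`.
        exact (hw'.swap_sigmaOf hX).trans ih

theorem condIndepGiven_of_markovBlanket_subset [DecidableEq V] [IsProbabilityMeasure μ]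
    {X : ∀ v, Ω → α v} (hX : ∀ v, Measurable (X v)) (hG : IsAcyclic G)
    (hP : Factorizes G X μ) {x y : V} (hxy : x ≠ y) {S : Set V} (hS : markovBlanket G x ⊆ S)
    (hxS : x ∉ S) :
    CondIndepGiven X hX μ x y S := by
  obtain ⟨κ, hκ, l, hl, hμ⟩ := hP
  have hle := sigmaOf_le (mΩ := mΩ) hX
  have huniv : {v | v ∈ l} = Set.univ := Set.eq_univ_of_forall hl.2.1
  have h := (screensOff_blanketWithin hX hG hl hμ x l [] (by simp) (hl.2.1 x)).2
  rw [huniv, blanketWithin_univ] at h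
  have h₁ : {y} ∪ S ⊆ Set.univ \ {x} := by
    rintro u (rfl | hu)
    · exact ⟨trivial, fun e => hxy e.symm⟩
    · exact ⟨trivial, fun e => hxS (e ▸ hu)⟩
  -- Decomposition shrinks the large set to `{y} ∪ S`; weak union then enlarges the blanket to `S`.
  have h₂ : ScreensOff (sigmaOf X {x}) (sigmaOf X S) (sigmaOf X ({y} ∪ S)) μ :=
    (h.of_le (sigmaOf_mono X (hS.trans Set.subset_union_right)) (sigmaOf_mono X h₁)
      (hle _)).of_le_of_le (sigmaOf_mono X hS) (sigmaOf_mono X Set.subset_union_right) (hle _)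
  rw [sigmaOf_union] at h₂
  have h₃ := (condIndep_iff_screensOff (hle {x}) (hle {y}) (hle S)).2 h₂
  rw [CondIndepGiven, condIndepFun_iff_condIndep]
  simpa only [sigmaOf_singleton] using h₃

end Blanket

end BayesNet

theorem mainTheorem7 {V : Type*} [Fintype V] [DecidableEq V] {α : V → Type*}
    [∀ v, MeasurableSpace (α v)] {Ω : Type*} [MeasurableSpace Ω] [StandardBorelSpace Ω]
    (μ : Measure Ω) [IsProbabilityMeasure μ]
    (X : ∀ v, Ω → α v) (hX : ∀ v, Measurable (X v))
    (G : Digraph V) (hG : BayesNet.IsAcyclic G) (hP : BayesNet.Factorizes G X μ)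
    (x y : V) (hxy : x ≠ y) (hy : y ∉ BayesNet.markovBlanket G x) :
    BayesNet.CondIndepGiven X hX μ x y (BayesNet.markovBlanket G x) ∧
    BayesNet.CondIndepGiven X hX μ x y (BayesNet.markovBlanket G y) ∧
    ∀ Z : Set V, x ∉ Z → y ∉ Z → Disjoint (BayesNet.markovBlanket G x) Z →
      BayesNet.CondIndepGiven X hX μ x y (BayesNet.markovBlanket G x ∪ Z) := by
  refine ⟨?_, ?_, fun Z hxZ _ _ => ?_⟩
  · exact BayesNet.condIndepGiven_of_markovBlanket_subset hX hG hP hxy subset_rfl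
      (BayesNet.notMem_markovBlanket_self hG x)
  · exact (BayesNet.condIndepGiven_of_markovBlanket_subset hX hG hP hxy.symm subset_rfl
      (BayesNet.notMem_markovBlanket_self hG y)).symm
  · exact BayesNet.condIndepGiven_of_markovBlanket_subset hX hG hP hxy Set.subset_union_left
      (by simp [BayesNet.notMem_markovBlanket_self hG x, hxZ])
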